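/- Let $d \ge 2$, and let $\mathbb{L}^d = (\mathbb{Z}^d, \mathbb{E})$ be the hypercubic lattice, in which $x, y \in \mathbb{Z}^d$ are joined by an edge exactly when $\sum_{i=1}^d |x_i - y_i| = 1$. Let $\Omega = \{0,1\}^{\mathbb{E}}$, with the product $\sigma$-field $\mathcal{F}$ generated by the finite-dimensional cylinder sets. An edge $e$ is called open in $\omega \in \Omega$ if $\omega(e) = 1$, and $I(\omega) \in \{0, 1, 2, \dots\} \cup \{\infty\}$ denotes the number of infinite connected components of the graph with vertex set $\mathbb{Z}^d$ whose edges are the open edges of $\omega$. Let $\mu$ be a probability measure on $(\Omega, \mathcal{F})$ that is invariant under all translations of $\mathbb{Z}^d$ and has the finite-energy property: for every $e \in \mathbb{E}$, $$0 < \mu(e \text{ is open} \mid \mathcal{T}_e) < 1 \quad \mu\text{-almost surely},$$ where $\mathcal{T}_e$ is the $\sigma$-field generated by the states of all edges other than $e$. Then the event $\{I \in \{0,1\}\}$ belongs to $\mathcal{F}$, and $\mu(I \in \{0,1\}) = 1$. -/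

import Mathlib

open MeasureTheory
open scoped ProbabilityTheory

namespace BondPercolation

/-- The `d`-dimensional hypercubic lattice: the vertex set is `ℤ^d`, and `x`, `y` are joined by an
edge exactly when `∑ i, |x i - y i| = 1`. -/
def lattice (d : ℕ) : SimpleGraph (Fin d → ℤ) where
  Adj x y := ∑ i, |x i - y i| = 1
  symm := ⟨fun x y h => by simpa only [abs_sub_comm] using h⟩
  loopless := ⟨fun x h => by simp at h⟩

/-- The set of (unoriented, nearest-neighbour) edges of the lattice. -/
abbrev Edge (d : ℕ) : Type := (lattice d).edgeSet

/-- Configurations `ω ∈ {0,1}^E`, where `true` stands for `1` (open) and `false` for `0` (closed).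
The σ-field is the product one, generated by the finite-dimensional cylinder sets. -/
abbrev Config (d : ℕ) : Type := Edge d → Bool

/-- The graph on all of `ℤ^d` whose edges are the open edges of `ω`. -/
def openSubgraph {d : ℕ} (ω : Config d) : SimpleGraph (Fin d → ℤ) :=
  SimpleGraph.fromEdgeSet (Subtype.val '' {e : Edge d | ω e = true})

/-- The number `I(ω)` of infinite components (infinite open clusters) of the open subgraph,
as an element of `{0, 1, 2, …, ∞}`. -/
noncomputable def numInfiniteClusters {d : ℕ} (ω : Config d) : ℕ∞ :=
  {C : (openSubgraph ω).ConnectedComponent | C.supp.Infinite}.encard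

/-- The translation `x ↦ x + a` as an automorphism of the lattice. -/
def translation {d : ℕ} (a : Fin d → ℤ) : lattice d ≃g lattice d where
  toEquiv := Equiv.addRight a
  map_rel_iff' := by intro x y; simp [lattice]

/-- The action of a translation on configurations: `(translate a ω)(e) = ω(e + a)`. -/
def translate {d : ℕ} (a : Fin d → ℤ) (ω : Config d) : Config d :=
  fun e => ω ((translation a).mapEdgeSet e)

/-- `μ` is invariant under all translations of the lattice. -/
def TranslationInvariant {d : ℕ} (μ : Measure (Config d)) : Prop :=
  ∀ a : Fin d → ℤ, MeasurePreserving (translate a) μ μ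

/-- The finite-energy property: for each edge `e`, the conditional probability that `e` is open,
given the σ-field `𝒯_e` generated by the states of all the edges other than `e`, lies almost surely
strictly between `0` and `1`. -/
def FiniteEnergy {d : ℕ} (μ : Measure (Config d)) : Prop :=
  ∀ e : Edge d, ∀ᵐ ω ∂μ,
    0 < (μ⟦{η : Config d | η e = true} | cylinderEvents {f : Edge d | f ≠ e}⟧) ω ∧
      (μ⟦{η : Config d | η e = true} | cylinderEvents {f : Edge d | f ≠ e}⟧) ω < 1

end BondPercolation

/-! # Uniqueness of the infinite cluster

The proof is that of Burton and Keane, with finite sets of vertices in place of trifurcation points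
and without ergodic decomposition.

*Opening edges.* By the finite-energy property, opening a finite set of edges is a
quasi-measure-preserving map (`FiniteEnergy.quasiMeasurePreserving_openEdges`): an event that
occurs with positive probability after the change has positive probability in the original model.
Moreover a translation-invariant event is, up to null sets, not affected by this change
(`preimage_openEdges_ae_eq`), since it is approximated by cylinder events that live arbitrarily far
away. This replaces the assumption of ergodicity.

*Three clusters.* A finite set `B` of vertices is a *furcation set* if it is connected by open edges
and at least three infinite components remain next to it after its deletion. If three infinite
clusters exist with positive probability, then some finite connected `B` meets three of them with
positive probability, and opening all edges within `B` turns it into a furcation set. By translation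
invariance every translate of `B` is then a furcation set with the same positive probability, so a
large cube contains on average at least a positive multiple of its volume of disjoint ones. But
disjoint furcation sets inside a finite region are at most as many as the vertices of the outer
boundary of the region (`card_furcation_le`): each of them partitions the boundary vertices in its
cluster into at least three classes, any two partitions of the same cluster are compatible (one
class of each suffice to cover it), and the least element of the class that comes
third, in the order of least elements, determines the furcation set
(`card_le_of_compatible_partitions`). Since the surface of a cube is negligible
compared to its volume, this is a contradiction (`measure_isFurcation_eq_zero`).

*Two clusters.* If there were exactly two infinite clusters, then opening the edges of a finite
connected set that meets both would leave one. As the event of having at most one infinite cluster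
is invariant, it is almost surely not affected by the change (`ae_atMostOneInfiniteCluster`).
-/

namespace BondPercolation

/-! ### Furcation sets of a graph, and how many there can be -/

section Graph

variable {V : Type*}

/-- The vertex `x` lies in an infinite connected component of `G`. -/
def InInfiniteCluster (G : SimpleGraph V) (x : V) : Prop :=
  {y | G.Reachable x y}.Infinite

/-- `G` has at most one infinite component. -/
def AtMostOneInfiniteCluster (G : SimpleGraph V) : Prop :=
  ∀ x y, InInfiniteCluster G x → InInfiniteCluster G y → G.Reachable x y

/-- The graph obtained from `G` by deleting all edges that touch `B`. The vertices of `B` are kept,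
as isolated vertices, so that all the graphs under consideration live on the same vertex set. -/
def avoid (G : SimpleGraph V) (B : Set V) : SimpleGraph V where
  Adj x y := G.Adj x y ∧ x ∉ B ∧ y ∉ B
  symm := ⟨fun _ _ h => ⟨h.1.symm, h.2.2, h.2.1⟩⟩
  loopless := ⟨fun _ h => h.1.ne rfl⟩

/-- `B` is a furcation set of `G`: it is connected by edges of `G` with both ends in `B`, and it is
adjacent to at least three distinct infinite components of the graph left after deleting `B`. -/
def IsFurcation (G : SimpleGraph V) (B : Set V) : Prop :=
  (∀ p ∈ B, ∀ q ∈ B, (avoid G Bᶜ).Reachable p q) ∧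
    ∃ a b c : V,
      ((∃ p ∈ B, G.Adj p a) ∧ InInfiniteCluster (avoid G B) a) ∧
      ((∃ p ∈ B, G.Adj p b) ∧ InInfiniteCluster (avoid G B) b) ∧
      ((∃ p ∈ B, G.Adj p c) ∧ InInfiniteCluster (avoid G B) c) ∧
      ¬ (avoid G B).Reachable a b ∧ ¬ (avoid G B).Reachable a c ∧ ¬ (avoid G B).Reachable b c

theorem avoid_le (G : SimpleGraph V) (B : Set V) : avoid G B ≤ G := fun _ _ h => h.1

theorem avoid_anti (G : SimpleGraph V) {B C : Set V} (h : B ⊆ C) : avoid G C ≤ avoid G B :=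
  fun _ _ hxy => ⟨hxy.1, fun hx => hxy.2.1 (h hx), fun hy => hxy.2.2 (h hy)⟩

theorem reachable_induction {G : SimpleGraph V} {u : V} {P : V → Prop} (h0 : P u)
    (hs : ∀ w y, G.Reachable u w → G.Adj w y → P w → P y) {z : V} (h : G.Reachable u z) : P z := by
  have h' := (SimpleGraph.reachable_iff_reflTransGen u z).1 h
  induction h' with
  | refl => exact h0
  | tail hw hy ih =>
    have hr := (SimpleGraph.reachable_iff_reflTransGen _ _).2 hw
    exact hs _ _ hr hy (ih hr)

theorem InInfiniteCluster.congr {G : SimpleGraph V} {x y : V} (h : InInfiniteCluster G x)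
    (hxy : G.Reachable x y) : InInfiniteCluster G y :=
  h.mono fun _ hz => hxy.symm.trans hz

theorem eq_of_reachable_avoid {G : SimpleGraph V} {B : Set V} {x y : V} (hx : x ∈ B)
    (h : (avoid G B).Reachable x y) : y = x :=
  reachable_induction (P := fun y => y = x) rfl
    (fun w y _ (hwy : (avoid G B).Adj w y) hw => absurd (hw ▸ hx) hwy.2.1) h

theorem InInfiniteCluster.notMem {G : SimpleGraph V} {B : Set V} {x : V}
    (h : InInfiniteCluster (avoid G B) x) : x ∉ B := fun hx =>
  h ((Set.finite_singleton x).subset fun _ hy => eq_of_reachable_avoid hx hy)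

/-- The last step at which a path from `B` leaves `B`. -/
theorem exists_last_exit {G : SimpleGraph V} {B : Set V} {u z : V} (hu : u ∈ B) (hz : z ∉ B)
    (h : G.Reachable u z) :
    ∃ b ∈ B, ∃ y ∉ B, G.Adj b y ∧ (avoid G B).Reachable y z := by
  refine reachable_induction (G := G) (u := u)
    (P := fun z => z ∉ B → ∃ b ∈ B, ∃ y ∉ B, G.Adj b y ∧ (avoid G B).Reachable y z)
    (fun hn => absurd hu hn) ?_ h hz
  intro w y _ hwy ih hy
  by_cases hw : w ∈ B
  · exact ⟨w, hw, y, hy, hwy, SimpleGraph.Reachable.refl _⟩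
  · obtain ⟨b, hb, y', hy', hadj, hr⟩ := ih hw
    have hwy' : (avoid G B).Adj w y := ⟨hwy, hw, hy⟩
    exact ⟨b, hb, y', hy', hadj, hr.trans hwy'.reachable⟩

/-- If `G'` arises from `G` by adding edges within a finite set of vertices, then every infinite
component of `G'` contains an infinite component of `G`: it is covered by the components in `G` of
finitely many of its vertices. -/
theorem exists_inInfiniteCluster_of_finite_change {G G' : SimpleGraph V}
    {S : Set V} (hS : S.Finite) (hadj : ∀ v w, G'.Adj v w → G.Adj v w ∨ w ∈ S) {u : V}
    (hu : InInfiniteCluster G' u) : ∃ z, G'.Reachable u z ∧ InInfiniteCluster G z := by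
  by_contra! hcon
  have hfin : (⋃ z ∈ insert u S ∩ {z | G'.Reachable u z}, {y | G.Reachable z y}).Finite := by
    refine ((hS.insert u).inter_of_left _).biUnion fun z hz => ?_
    exact Set.not_infinite.1 (hcon z hz.2)
  refine hu (hfin.subset fun y hy => ?_)
  refine reachable_induction (G := G') (u := u)
    (P := fun y => y ∈ ⋃ z ∈ insert u S ∩ {z | G'.Reachable u z}, {y | G.Reachable z y}) ?_ ?_ hy
  · simp only [Set.mem_iUnion]
    exact ⟨u, ⟨Set.mem_insert _ _, SimpleGraph.Reachable.refl _⟩, SimpleGraph.Reachable.refl _⟩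
  · intro w y hw hwy ih
    simp only [Set.mem_iUnion] at ih ⊢
    obtain ⟨z, hz, hzw⟩ := ih
    rcases hadj w y hwy with h | h
    · exact ⟨z, hz, SimpleGraph.Reachable.trans hzw h.reachable⟩
    · exact ⟨y, ⟨Set.mem_insert_of_mem _ h, hw.trans hwy.reachable⟩, SimpleGraph.Reachable.refl _⟩

/-- A finite set with finite neighbourhood that meets an infinite cluster is adjacent to an
infinite piece of that cluster with the set removed. -/
theorem exists_infinite_branch {G : SimpleGraph V} {B : Set V} (hB : B.Finite)
    (hN : {w | ∃ v ∈ B, G.Adj v w}.Finite) {x : V} (hx : x ∈ B) (hinf : InInfiniteCluster G x) :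
    ∃ a, G.Reachable x a ∧ (∃ p ∈ B, G.Adj p a) ∧ InInfiniteCluster (avoid G B) a := by
  obtain ⟨z, hxz, hz⟩ := exists_inInfiniteCluster_of_finite_change (G := avoid G B) (hB.union hN)
    (fun v w hvw => by
      by_cases hv : v ∈ B
      · exact Or.inr (Or.inr ⟨v, hv, hvw⟩)
      · by_cases hw : w ∈ B
        · exact Or.inr (Or.inl hw)
        · exact Or.inl ⟨hvw, hv, hw⟩) hinf
  obtain ⟨b, hb, a, -, hba, haz⟩ := exists_last_exit hx hz.notMem hxz
  exact ⟨a, hxz.trans (haz.mono (avoid_le G B)).symm, ⟨b, hb, hba⟩, hz.congr haz.symm⟩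

/-- If a finite set meets three infinite clusters of `G`, then adding edges inside the set so that
it becomes connected turns it into a furcation set. -/
theorem isFurcation_of_three_clusters {G G' : SimpleGraph V} (hle : G ≤ G') {B : Set V}
    (hB : B.Finite) (hN : {w | ∃ v ∈ B, G.Adj v w}.Finite) (havoid : avoid G' B = avoid G B)
    (hconn : ∀ p ∈ B, ∀ q ∈ B, (avoid G' Bᶜ).Reachable p q) {x y z : V}
    (hx : x ∈ B) (hy : y ∈ B) (hz : z ∈ B) (hxi : InInfiniteCluster G x)
    (hyi : InInfiniteCluster G y) (hzi : InInfiniteCluster G z) (hxy : ¬ G.Reachable x y)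
    (hxz : ¬ G.Reachable x z) (hyz : ¬ G.Reachable y z) : IsFurcation G' B := by
  obtain ⟨a, hxa, ⟨p, hp, hpa⟩, ha⟩ := exists_infinite_branch hB hN hx hxi
  obtain ⟨b, hyb, ⟨q, hq, hqb⟩, hb⟩ := exists_infinite_branch hB hN hy hyi
  obtain ⟨c, hzc, ⟨r, hr, hrc⟩, hc⟩ := exists_infinite_branch hB hN hz hzi
  refine ⟨hconn, a, b, c, ⟨⟨p, hp, hle hpa⟩, ?_⟩, ⟨⟨q, hq, hle hqb⟩, ?_⟩, ⟨⟨r, hr, hle hrc⟩, ?_⟩,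
    ?_⟩
  iterate 3 rwa [havoid]
  rw [havoid]
  have key : ∀ {s t s' t' : V}, G.Reachable s s' → G.Reachable t t' → ¬ G.Reachable s t →
      ¬ (avoid G B).Reachable s' t' := fun h1 h2 h3 h4 =>
    h3 (h1.trans ((h4.mono (avoid_le G B)).trans h2.symm))
  exact ⟨key hxa hyb hxy, key hxa hzc hxz, key hyb hzc hyz⟩

/-- The combinatorial heart of the counting argument. For each `i`, the subset `K i` of `Y` is
partitioned by the equivalence relation `r i` into at least three classes; for `i ≠ j` the sets
`K i`, `K j` are disjoint or equal, and in the latter case they are covered by one class of `r i`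
and one class of `r j`. Order the classes of `r i` by their least elements: the least element of the
third class determines `i`, so that there are at most `Y.card` indices. -/
theorem card_le_of_compatible_partitions {ι : Type*} (s : Finset ι) (Y : Finset V) {g : V → ℕ}
    (hg : Function.Injective g) (K : ι → V → Prop) (r : ι → V → V → Prop)
    (hr : ∀ i, Equivalence (r i))
    (h3 : ∀ i ∈ s, ∃ a ∈ Y, ∃ b ∈ Y, ∃ c ∈ Y, K i a ∧ K i b ∧ K i c ∧
      ¬ r i a b ∧ ¬ r i a c ∧ ¬ r i b c)
    (hK : ∀ i ∈ s, ∀ j ∈ s, ∀ y, K i y → K j y → ∀ z, K i z → K j z)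
    (hc : ∀ i ∈ s, ∀ j ∈ s, i ≠ j → ∃ p q, ∀ y ∈ Y, K i y → K j y → r i y p ∨ r j y q) :
    s.card ≤ Y.card := by
  classical
  rcases s.eq_empty_or_nonempty with rfl | ⟨i₀, hi₀⟩
  · simp
  have : Nonempty V := ⟨(h3 i₀ hi₀).choose⟩
  have hmin : ∀ P : V → Prop, (∃ y ∈ Y, P y) →
      ∃ y ∈ Y, P y ∧ ∀ z ∈ Y, P z → g y ≤ g z := by
    rintro P ⟨y, hy, hPy⟩
    obtain ⟨x, hx, hxm⟩ := Finset.exists_min_image (Y.filter P) g ⟨y, by simp [hy, hPy]⟩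
    rw [Finset.mem_filter] at hx
    exact ⟨x, hx.1, hx.2, fun z hz hPz => hxm z (by simp [hz, hPz])⟩
  have hex : ∀ i ∈ s, ∃ m ∈ Y, ∃ t ∈ Y, ∃ f ∈ Y,
      (K i m ∧ ∀ z ∈ Y, K i z → g m ≤ g z) ∧
      ((K i t ∧ ¬ r i m t) ∧ ∀ z ∈ Y, K i z ∧ ¬ r i m z → g t ≤ g z) ∧
      ((K i f ∧ ¬ r i m f ∧ ¬ r i t f) ∧
        ∀ z ∈ Y, K i z ∧ ¬ r i m z ∧ ¬ r i t z → g f ≤ g z) := by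
    intro i hi
    obtain ⟨a, ha, b, hb, c, hc, hKa, hKb, hKc, hab, hac, hbc⟩ := h3 i hi
    have hs := fun {x y} => (hr i).symm (x := x) (y := y)
    have ht := fun {x y z} => (hr i).trans (x := x) (y := y) (z := z)
    obtain ⟨m, hm, hm1, hm2⟩ := hmin (K i) ⟨a, ha, hKa⟩
    obtain ⟨t, ht', ht1, ht2⟩ := hmin (fun z => K i z ∧ ¬ r i m z) (by
      by_cases h : r i m a
      · exact ⟨b, hb, hKb, fun h' => hab (ht (hs h) h')⟩
      · exact ⟨a, ha, hKa, h⟩)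
    obtain ⟨f, hf, hf1, hf2⟩ := hmin (fun z => K i z ∧ ¬ r i m z ∧ ¬ r i t z) (by
      by_contra! hcon
      have h1 := hcon a ha hKa
      have h2 := hcon b hb hKb
      have h3 := hcon c hc hKc
      by_cases hma : r i m a
      · have hmb : ¬ r i m b := fun h' => hab (ht (hs hma) h')
        have hmc : ¬ r i m c := fun h' => hac (ht (hs hma) h')
        exact hbc (ht (hs (h2 hmb)) (h3 hmc))
      · by_cases hmb : r i m b
        · have hmc : ¬ r i m c := fun h' => hbc (ht (hs hmb) h')
          exact hac (ht (hs (h1 hma)) (h3 hmc))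
        · exact hab (ht (hs (h1 hma)) (h2 hmb)))
    exact ⟨m, hm, t, ht', f, hf, ⟨hm1, hm2⟩, ⟨ht1, ht2⟩, hf1, hf2⟩
  choose! m hm t ht f hf hM hT hF using hex
  refine Finset.card_le_card_of_injOn f (fun i hi => hf i hi) ?_
  intro i hi j hj hij
  by_contra hne
  have hKi : ∀ z, K i z → K j z := hK i hi j hj (f i) (hF i hi).1.1 (hij ▸ (hF j hj).1.1)
  have hKj : ∀ z, K j z → K i z := hK j hj i hi (f i) (hij ▸ (hF j hj).1.1) (hF i hi).1.1
  have hmm : m i = m j := hg (le_antisymm ((hM i hi).2 _ (hm j hj) (hKj _ (hM j hj).1))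
    ((hM j hj).2 _ (hm i hi) (hKi _ (hM i hi).1)))
  -- If the common least element lies in the chosen class of `r i`, then the second and third
  -- classes of `r i` lie in one class of `r j`, whose least element precedes `f i`.
  have key : ∀ i ∈ s, ∀ j ∈ s, f i = f j → m i = m j → (∀ z, K i z → K j z) →
      ∀ p q, (∀ y ∈ Y, K i y → r i y p ∨ r j y q) → r i (m i) p → False := by
    intro i hi j hj hij hmm hKi p q hpq hmp
    have hq : ∀ z ∈ Y, K i z → ¬ r i (m i) z → r j z q := fun z hz hKz hz' =>
      (hpq z hz hKz).resolve_left fun h => hz' ((hr i).trans hmp ((hr i).symm h))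
    have h1 : r j (t i) q := hq _ (ht i hi) (hT i hi).1.1 (hT i hi).1.2
    have h2 : r j (f i) q := hq _ (hf i hi) (hF i hi).1.1 (hF i hi).1.2.1
    have htf : r j (t i) (f j) := hij ▸ (hr j).trans h1 ((hr j).symm h2)
    have hlt : g (t i) < g (f i) := by
      refine lt_of_le_of_ne ((hT i hi).2 _ (hf i hi) ⟨(hF i hi).1.1, (hF i hi).1.2.1⟩) fun h => ?_
      exact (hF i hi).1.2.2 (hg h ▸ (hr i).refl _)
    have hle := (hF j hj).2 (t i) (ht i hi) ⟨hKi _ (hT i hi).1.1,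
      fun h => (hF j hj).1.2.1 ((hr j).trans h htf), fun h => (hF j hj).1.2.2 ((hr j).trans h htf)⟩
    rw [← hij] at hle
    omega
  obtain ⟨p, q, hpq⟩ := hc i hi j hj hne
  rcases hpq (m i) (hm i hi) (hM i hi).1 (hKi _ (hM i hi).1) with h | h
  · exact key i hi j hj hij hmm hKi p q (fun y hy hKy => hpq y hy hKy (hKi y hKy)) h
  · exact key j hj i hi hij.symm hmm.symm hKj q p
      (fun y hy hKy => (hpq y hy (hKj y hKy) hKy).symm) (hmm ▸ h)

/-- Disjoint furcation sets `B i`, `B j` are compatible: a vertex of their cluster outside both is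
joined to `B j` without using `B i`, or joined to `B i` without using `B j`. -/
theorem reachable_avoid_or_reachable_avoid {G : SimpleGraph V} {B C : Set V} (hBC : Disjoint B C)
    (hB : ∀ p ∈ B, ∀ q ∈ B, (avoid G Bᶜ).Reachable p q)
    (hC : ∀ p ∈ C, ∀ q ∈ C, (avoid G Cᶜ).Reachable p q) {y p q u : V} (hyB : y ∉ B) (hyC : y ∉ C)
    (hp : p ∈ C) (hq : q ∈ B) (hu : u ∈ B) (huy : G.Reachable u y) :
    (avoid G B).Reachable y p ∨ (avoid G C).Reachable y q := by
  obtain ⟨b, hb, z, hz, hbz, hzy⟩ := exists_last_exit (B := B ∪ C) (Or.inl hu)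
    (by rintro (h | h) <;> contradiction) huy
  have hzB : z ∉ B := fun h => hz (Or.inl h)
  have hzC : z ∉ C := fun h => hz (Or.inr h)
  rcases hb with hb | hb
  · right
    have h1 : (avoid G C).Adj z b := ⟨hbz.symm, hzC, Set.disjoint_left.1 hBC hb⟩
    exact ((hzy.mono (avoid_anti G Set.subset_union_right)).symm.trans h1.reachable).trans
      ((hB b hb q hq).mono (avoid_anti G hBC.symm.subset_compl_right))
  · left
    have h1 : (avoid G B).Adj z b := ⟨hbz.symm, hzB, Set.disjoint_right.1 hBC hb⟩
    exact ((hzy.mono (avoid_anti G Set.subset_union_left)).symm.trans h1.reachable).trans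
      ((hC b hb p hp).mono (avoid_anti G hBC.subset_compl_right))

/-- An infinite component left after deleting `B ⊆ L`, if it is adjacent to `B`, meets the outer
boundary `Y` of the finite set `L`. -/
theorem exists_boundary_of_infinite {G : SimpleGraph V} {L Y : Finset V}
    (hY : ∀ u ∈ L, ∀ w ∉ L, G.Adj u w → w ∈ Y) {B : Set V} (hB : B ⊆ L) {a : V}
    (ha : (∃ p ∈ B, G.Adj p a) ∧ InInfiniteCluster (avoid G B) a) :
    ∃ y ∈ Y, (avoid G B).Reachable a y := by
  obtain ⟨⟨p, hp, hpa⟩, hinf⟩ := ha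
  by_cases haL : a ∈ L
  · obtain ⟨w, hw, hwL⟩ := hinf.exists_notMem_finset L
    obtain ⟨b, hb, y, hyL, hby, hyw⟩ := exists_last_exit (B := (L : Set V)) (u := a) (z := w)
      haL hwL hw
    exact ⟨y, hY b hb y hyL hby.1,
      SimpleGraph.Reachable.trans hw (hyw.mono (avoid_le _ _)).symm⟩
  · exact ⟨a, hY p (hB hp) a haL hpa, SimpleGraph.Reachable.refl _⟩

/-- Disjoint furcation sets inside a finite region `L` are at most as many as the vertices of the
outer boundary `Y` of `L`. -/
theorem card_furcation_le {ι : Type*} {G : SimpleGraph V} (s : Finset ι) (L Y : Finset V)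
    {g : V → ℕ} (hg : Function.Injective g) (hLY : Disjoint L Y)
    (hY : ∀ u ∈ L, ∀ w ∉ L, G.Adj u w → w ∈ Y) (B : ι → Set V) (hBL : ∀ i ∈ s, B i ⊆ L)
    (hdisj : ∀ i ∈ s, ∀ j ∈ s, i ≠ j → Disjoint (B i) (B j))
    (hfur : ∀ i ∈ s, IsFurcation G (B i)) : s.card ≤ Y.card := by
  have hout : ∀ i ∈ s, ∀ y ∈ Y, y ∉ B i := fun i hi y hy h =>
    Finset.disjoint_left.1 hLY (hBL i hi h) hy
  have hconn : ∀ i ∈ s, ∀ p ∈ B i, ∀ q ∈ B i, G.Reachable p q := fun i hi p hp q hq =>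
    ((hfur i hi).1 p hp q hq).mono (avoid_le _ _)
  refine card_le_of_compatible_partitions s Y hg (fun i y => ∃ q ∈ B i, G.Reachable q y)
    (fun i => (avoid G (B i)).Reachable) (fun i => SimpleGraph.reachable_is_equivalence _) ?_ ?_ ?_
  · intro i hi
    obtain ⟨-, a, b, c, ha, hb, hc, hab, hac, hbc⟩ := hfur i hi
    obtain ⟨a', ha', haa⟩ := exists_boundary_of_infinite hY (hBL i hi) ha
    obtain ⟨b', hb', hbb⟩ := exists_boundary_of_infinite hY (hBL i hi) hb
    obtain ⟨c', hc', hcc⟩ := exists_boundary_of_infinite hY (hBL i hi) hc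
    have hK : ∀ {v w}, (∃ p ∈ B i, G.Adj p v) → (avoid G (B i)).Reachable v w →
        ∃ q ∈ B i, G.Reachable q w := fun ⟨p, hp, hpv⟩ hvw =>
      ⟨p, hp, hpv.reachable.trans (hvw.mono (avoid_le _ _))⟩
    exact ⟨a', ha', b', hb', c', hc', hK ha.1 haa, hK hb.1 hbb, hK hc.1 hcc,
      fun h => hab ((haa.trans h).trans hbb.symm), fun h => hac ((haa.trans h).trans hcc.symm),
      fun h => hbc ((hbb.trans h).trans hcc.symm)⟩
  · rintro i hi j hj y ⟨p, hp, hpy⟩ ⟨q, hq, hqy⟩ z ⟨p', hp', hpz⟩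
    exact ⟨q, hq, (hqy.trans hpy.symm).trans ((hconn i hi p hp p' hp').trans hpz)⟩
  · intro i hi j hj hij
    obtain ⟨-, a, -, -, ⟨⟨q, hq, -⟩, -⟩, -⟩ := hfur i hi
    obtain ⟨-, a, -, -, ⟨⟨p, hp, -⟩, -⟩, -⟩ := hfur j hj
    refine ⟨p, q, fun y hy ⟨u, hu, huy⟩ _ => ?_⟩
    exact reachable_avoid_or_reachable_avoid (hdisj i hi j hj hij) (hfur i hi).1 (hfur j hj).1
      (hout i hi y hy) (hout j hj y hy) hp hq hu huy

end Graph

/-! ### Opening finitely many edges -/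

section Insertion

variable {d : ℕ}

open Classical in
/-- The configuration obtained from `ω` by opening all edges of `S`. -/
noncomputable def openEdges (S : Set (Edge d)) (ω : Config d) : Config d :=
  fun e => if e ∈ S then true else ω e

theorem openEdges_of_mem {S : Set (Edge d)} {e : Edge d} (he : e ∈ S) (ω : Config d) :
    openEdges S ω e = true := if_pos he

theorem openEdges_of_notMem {S : Set (Edge d)} {e : Edge d} (he : e ∉ S) (ω : Config d) :
    openEdges S ω e = ω e := if_neg he

theorem measurable_openEdges_cylinderEvents (S : Set (Edge d)) :
    Measurable[cylinderEvents Sᶜ] (openEdges S) := by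
  refine (@measurable_pi_iff _ _ _ (cylinderEvents Sᶜ) _ _).2 fun e => ?_
  by_cases he : e ∈ S
  · simp only [openEdges_of_mem he]
    exact measurable_const
  · simp only [openEdges_of_notMem he]
    exact measurable_cylinderEvent_apply (X := fun _ : Edge d => Bool) (Δ := Sᶜ) he

theorem measurable_openEdges (S : Set (Edge d)) : Measurable (openEdges S) :=
  (measurable_openEdges_cylinderEvents S).mono cylinderEvents_le_pi le_rfl

theorem openEdges_insert (e : Edge d) (S : Set (Edge d)) :
    openEdges (insert e S) = openEdges {e} ∘ openEdges S := by
  funext ω f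
  by_cases hf : f = e <;> by_cases hS : f ∈ S <;> simp [openEdges, hf, hS]

/-- Insertion tolerance: opening one edge maps `μ` to a measure that is absolutely continuous with
respect to `μ`. The preimage of a null set is determined by the other edges, and given those the
edge is open with positive conditional probability. -/
theorem FiniteEnergy.quasiMeasurePreserving_openEdges_singleton {μ : Measure (Config d)}
    [IsProbabilityMeasure μ] (hfe : FiniteEnergy μ) (e : Edge d) :
    Measure.QuasiMeasurePreserving (openEdges {e}) μ μ := by
  refine ⟨measurable_openEdges _, Measure.AbsolutelyContinuous.mk fun N hN hN0 => ?_⟩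
  rw [Measure.map_apply (measurable_openEdges _) hN]
  have hle : cylinderEvents {f : Edge d | f ≠ e} ≤
      (MeasurableSpace.pi : MeasurableSpace (Config d)) := cylinderEvents_le_pi
  have hM : MeasurableSet[cylinderEvents {f : Edge d | f ≠ e}] (openEdges {e} ⁻¹' N) :=
    measurable_openEdges_cylinderEvents {e} hN
  have hE : MeasurableSet {η : Config d | η e = true} :=
    measurable_pi_apply (X := fun _ : Edge d => Bool) e (measurableSet_singleton true)
  have hint : Integrable ({η : Config d | η e = true}.indicator fun _ => (1 : ℝ)) μ :=
    (integrable_const 1).indicator hE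
  have h1 := setIntegral_condExp hle hint hM
  have h2 : ∫ ω in openEdges {e} ⁻¹' N, ({η : Config d | η e = true}.indicator fun _ => (1 : ℝ)) ω ∂μ
      = 0 := by
    rw [setIntegral_indicator hE, setIntegral_const, measureReal_def,
      measure_mono_null _ hN0, ENNReal.toReal_zero, zero_smul]
    rintro ω ⟨hω, hωe : ω e = true⟩
    have : openEdges {e} ω = ω := by
      funext f
      by_cases hf : f = e <;> simp [openEdges, hf, hωe]
    rwa [Set.mem_preimage, this] at hω
  have hpos := hfe e
  rw [h2, setIntegral_eq_zero_iff_of_nonneg_ae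
    (ae_restrict_of_ae (hpos.mono fun ω h => h.1.le)) integrable_condExp.integrableOn] at h1
  have h3 : ∀ᵐ ω ∂μ.restrict (openEdges {e} ⁻¹' N), False := by
    filter_upwards [h1, ae_restrict_of_ae hpos] with ω ha hb
    exact hb.1.ne' ha
  simpa using h3

theorem FiniteEnergy.quasiMeasurePreserving_openEdges {μ : Measure (Config d)}
    [IsProbabilityMeasure μ] (hfe : FiniteEnergy μ) {S : Set (Edge d)} (hS : S.Finite) :
    Measure.QuasiMeasurePreserving (openEdges S) μ μ := by
  induction S, hS using Set.Finite.induction_on with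
  | empty =>
    have : openEdges (∅ : Set (Edge d)) = id := by
      funext ω e
      simp [openEdges]
    exact this ▸ Measure.QuasiMeasurePreserving.id μ
  | insert _ _ ih =>
    rw [openEdges_insert]
    exact (hfe.quasiMeasurePreserving_openEdges_singleton _).comp ih

/-- Some translation moves the finite set `F` of edges off the finite set `S`. -/
theorem exists_translation_disjoint (hd : 0 < d) (F : Finset (Edge d)) {S : Set (Edge d)}
    (hS : S.Finite) : ∃ a : Fin d → ℤ, ∀ f ∈ F, (translation a).mapEdgeSet f ∉ S := by
  have : Nonempty (Fin d) := ⟨⟨0, hd⟩⟩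
  have hfin : (⋃ f ∈ (F : Set (Edge d)), ⋃ e ∈ S,
      {a : Fin d → ℤ | (translation a).mapEdgeSet f = e}).Finite := by
    refine F.finite_toSet.biUnion fun f _ => hS.biUnion fun e _ => ?_
    obtain ⟨⟨x, y⟩, hf⟩ := f
    obtain ⟨⟨u, v⟩, he⟩ := e
    refine Set.Finite.subset (Set.toFinite {u - x, v - x}) fun a ha => ?_
    have h : s(x + a, y + a) = s(u, v) := congrArg Subtype.val ha
    rcases Sym2.eq_iff.1 h with ⟨h, -⟩ | ⟨h, -⟩
    · exact Or.inl (eq_sub_of_add_eq' h)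
    · exact Or.inr (eq_sub_of_add_eq' h)
  obtain ⟨a, ha⟩ := hfin.exists_notMem
  simp only [Set.mem_iUnion, not_exists] at ha
  exact ⟨a, fun f hf hfS => ha f hf _ hfS rfl⟩

/-- A translation-invariant event is, up to a null set, not affected by opening finitely many
edges. It is approximated by cylinder events, and by invariance these may be taken to depend only on
edges outside `S`; the upper limit of such a sequence is then not affected at all. -/
theorem preimage_openEdges_ae_eq {μ : Measure (Config d)} [IsProbabilityMeasure μ] (hd : 0 < d)
    (hinv : TranslationInvariant μ) (hfe : FiniteEnergy μ) {A : Set (Config d)}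
    (hA : MeasurableSet A) (hAinv : ∀ a, translate a ⁻¹' A = A) {S : Set (Edge d)}
    (hS : S.Finite) : openEdges S ⁻¹' A =ᵐ[μ] A := by
  have happrox : ∀ ε : ENNReal, 0 < ε → ∃ t : Set (Config d), openEdges S ⁻¹' t = t ∧
      μ (symmDiff t A) < ε := by
    intro ε hε
    obtain ⟨t, ht, hlt⟩ := exists_measure_symmDiff_lt_of_generateFrom_isSetRing (μ := μ)
      (C := measurableCylinders fun _ : Edge d => Bool) isSetRing_measurableCylinders
      ⟨{Set.univ}, Set.countable_singleton _,
        Set.singleton_subset_iff.2 (univ_mem_measurableCylinders _), by simp⟩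
      generateFrom_measurableCylinders.symm hA hε
    obtain ⟨F, T, hT, rfl⟩ := (mem_measurableCylinders t).1 ht
    obtain ⟨a, ha⟩ := exists_translation_disjoint hd F hS
    refine ⟨translate a ⁻¹' cylinder F T, ?_, ?_⟩
    · ext ω
      have : F.restrict (translate a (openEdges S ω)) = F.restrict (translate a ω) := by
        funext f
        exact openEdges_of_notMem (ha f f.2) ω
      simp only [Set.mem_preimage, mem_cylinder, this]
    · have hm : MeasurableSet (symmDiff (cylinder F T) A) :=
        (MeasurableSet.of_mem_measurableCylinders ht).symmDiff hA
      have := (hinv a).measure_preimage hm.nullMeasurableSet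
      rw [Set.preimage_symmDiff, hAinv] at this
      rwa [this]
  choose t ht hlt using fun n : ℕ => happrox ((2⁻¹ : ENNReal) ^ n)
    (ENNReal.pow_pos (by simp) n)
  have hsum : ∑' n, μ (symmDiff (t n) A) ≠ ⊤ := by
    refine ne_top_of_le_ne_top ?_ (ENNReal.tsum_le_tsum fun n => (hlt n).le)
    simp [ENNReal.tsum_geometric]
  let T : Set (Config d) := Filter.limsup t Filter.atTop
  have hT : ∀ ω, ω ∈ T ↔ ∃ᶠ n in Filter.atTop, ω ∈ t n := fun ω =>
    Filter.mem_limsup_iff_frequently_mem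
  have hae : T =ᵐ[μ] A := by
    filter_upwards [ae_eventually_notMem hsum] with ω hω
    apply propext
    change ω ∈ T ↔ ω ∈ A
    rw [hT]
    have hiff : ∀ᶠ n in Filter.atTop, (ω ∈ t n ↔ ω ∈ A) := hω.mono fun n hn => by
      rw [Set.mem_symmDiff] at hn
      tauto
    rw [Filter.frequently_congr hiff, Filter.frequently_const]
  have hpre : openEdges S ⁻¹' T = T := by
    ext ω
    simp only [Set.mem_preimage, hT]
    refine Filter.frequently_congr (Filter.Eventually.of_forall fun n => ?_)
    rw [← Set.mem_preimage, ht]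
  have h1 := (hfe.quasiMeasurePreserving_openEdges hS).preimage_ae_eq hae
  rw [hpre] at h1
  exact h1.symm.trans hae

end Insertion

/-! ### Transport along bijections of the vertex set -/

section Comap

variable {V W : Type*}

theorem avoid_comap (G : SimpleGraph W) (f : V ≃ W) (B : Set V) :
    avoid (G.comap f) B = (avoid G (f '' B)).comap f := by
  ext x y
  simp [avoid]

theorem reachable_comap (G : SimpleGraph W) (f : V ≃ W) {x y : V} :
    (G.comap f).Reachable x y ↔ G.Reachable (f x) (f y) :=
  (SimpleGraph.Iso.comap f G).reachable_iff.symm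

theorem inInfiniteCluster_comap (G : SimpleGraph W) (f : V ≃ W) {x : V} :
    InInfiniteCluster (G.comap f) x ↔ InInfiniteCluster G (f x) := by
  have h : {y | G.Reachable (f x) y} = f '' {y | (G.comap f).Reachable x y} := by
    ext y
    simp only [Set.mem_ofPred_eq, Set.mem_image, reachable_comap]
    exact ⟨fun h => ⟨f.symm y, by simpa using h, by simp⟩, by rintro ⟨z, hz, rfl⟩; exact hz⟩
  rw [InInfiniteCluster, InInfiniteCluster, h, Set.infinite_image_iff f.injective.injOn]

theorem IsFurcation.image {G : SimpleGraph W} {f : V ≃ W} {B : Set V}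
    (h : IsFurcation (G.comap f) B) : IsFurcation G (f '' B) := by
  obtain ⟨hconn, a, b, c, ha, hb, hc, hab, hac, hbc⟩ := h
  simp only [avoid_comap, reachable_comap, inInfiniteCluster_comap] at hconn ha hb hc hab hac hbc
  have hadj : ∀ {v}, (∃ p ∈ B, (G.comap f).Adj p v) → ∃ p ∈ f '' B, G.Adj p (f v) :=
    fun ⟨p, hp, hpv⟩ => ⟨f p, Set.mem_image_of_mem f hp, hpv⟩
  refine ⟨?_, f a, f b, f c, ⟨hadj ha.1, ha.2⟩, ⟨hadj hb.1, hb.2⟩, ⟨hadj hc.1, hc.2⟩, hab, hac, hbc⟩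
  rintro _ ⟨p, hp, rfl⟩ _ ⟨q, hq, rfl⟩
  rw [← Set.image_compl_eq f.bijective]
  exact hconn p hp q hq

end Comap

/-! ### Measurability -/

section Measurability

variable {Ω V : Type*} [MeasurableSpace Ω] {H : Ω → SimpleGraph V}

theorem measurableSet_reachable [Countable V]
    (hH : ∀ x y, MeasurableSet {ω | (H ω).Adj x y}) (x y : V) :
    MeasurableSet {ω | (H ω).Reachable x y} := by
  have hwalk : ∀ n : ℕ, ∀ x, MeasurableSet {ω | ∃ p : (H ω).Walk x y, p.length = n} := by
    intro n
    induction n with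
    | zero =>
      intro x
      by_cases hxy : x = y
      · subst hxy
        convert MeasurableSet.univ
        exact Set.eq_univ_of_forall fun ω => ⟨SimpleGraph.Walk.nil, rfl⟩
      · convert MeasurableSet.empty
        exact Set.eq_empty_of_forall_notMem fun ω ⟨p, hp⟩ =>
          hxy (SimpleGraph.Walk.eq_of_length_eq_zero hp)
    | succ n ih =>
      intro x
      have : {ω | ∃ p : (H ω).Walk x y, p.length = n + 1} =
          ⋃ z, {ω | (H ω).Adj x z} ∩ {ω | ∃ p : (H ω).Walk z y, p.length = n} := by
        ext ω
        simp only [Set.mem_iUnion, Set.mem_inter_iff, Set.mem_ofPred_eq]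
        constructor
        · rintro ⟨p, hp⟩
          cases p with
          | nil => simp at hp
          | cons h q => exact ⟨_, h, q, by simpa using hp⟩
        · rintro ⟨z, h, q, hq⟩
          exact ⟨SimpleGraph.Walk.cons h q, by simp [hq]⟩
      rw [this]
      exact MeasurableSet.iUnion fun z => (hH x z).inter (ih z)
  have : {ω | (H ω).Reachable x y} = ⋃ n, {ω | ∃ p : (H ω).Walk x y, p.length = n} := by
    ext ω
    simp only [Set.mem_iUnion, Set.mem_ofPred_eq]
    exact ⟨fun ⟨p⟩ => ⟨_, p, rfl⟩, fun ⟨_, p, _⟩ => ⟨p⟩⟩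
  rw [this]
  exact MeasurableSet.iUnion fun n => hwalk n x

theorem measurableSet_inInfiniteCluster [Countable V]
    (hH : ∀ x y, MeasurableSet {ω | (H ω).Adj x y}) (x : V) :
    MeasurableSet {ω | InInfiniteCluster (H ω) x} := by
  have : {ω | InInfiniteCluster (H ω) x} =
      ⋂ s : Finset V, ⋃ y : V, ⋃ _ : y ∉ s, {ω | (H ω).Reachable x y} := by
    ext ω
    simp only [Set.mem_iInter, Set.mem_iUnion, Set.mem_ofPred_eq, exists_prop]
    constructor
    · intro h s
      obtain ⟨y, hy, hys⟩ := Set.Infinite.exists_notMem_finset h s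
      exact ⟨y, hys, hy⟩
    · intro h hfin
      obtain ⟨y, hys, hy⟩ := h hfin.toFinset
      exact hys (hfin.mem_toFinset.2 hy)
  rw [this]
  exact MeasurableSet.iInter fun s => MeasurableSet.iUnion fun y => MeasurableSet.iUnion fun _ =>
    measurableSet_reachable hH x y

theorem measurableSet_avoid_adj (hH : ∀ x y, MeasurableSet {ω | (H ω).Adj x y}) (B : Set V)
    (x y : V) : MeasurableSet {ω | (avoid (H ω) B).Adj x y} :=
  (hH x y).inter (MeasurableSet.const (x ∉ B ∧ y ∉ B))

theorem measurableSet_isFurcation [Countable V]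
    (hH : ∀ x y, MeasurableSet {ω | (H ω).Adj x y}) (B : Set V) :
    MeasurableSet {ω | IsFurcation (H ω) B} := by
  have hA := fun p a => measurableSet_setOfPred.1 (hH p a)
  have hR := fun C x y => measurableSet_setOfPred.1
    (measurableSet_reachable (measurableSet_avoid_adj hH C) x y)
  have hI := fun C x => measurableSet_setOfPred.1
    (measurableSet_inInfiniteCluster (measurableSet_avoid_adj hH C) x)
  have hbr : ∀ a, Measurable fun ω =>
      (∃ p ∈ B, (H ω).Adj p a) ∧ InInfiniteCluster (avoid (H ω) B) a := fun a =>
    (Measurable.exists fun p => measurable_const.and (hA p a)).and (hI B a)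
  refine measurableSet_setOfPred.2 (Measurable.and ?_ ?_)
  · exact Measurable.forall fun p => measurable_const.imp <|
      Measurable.forall fun q => measurable_const.imp (hR Bᶜ p q)
  · exact Measurable.exists fun a => Measurable.exists fun b => Measurable.exists fun c =>
      (hbr a).and ((hbr b).and ((hbr c).and
        ((hR B a b).not.and ((hR B a c).not.and (hR B b c).not))))

theorem measurableSet_atMostOneInfiniteCluster [Countable V]
    (hH : ∀ x y, MeasurableSet {ω | (H ω).Adj x y}) :
    MeasurableSet {ω | AtMostOneInfiniteCluster (H ω)} :=
  measurableSet_setOfPred.2 <| Measurable.forall fun x => Measurable.forall fun y =>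
    (measurableSet_setOfPred.1 (measurableSet_inInfiniteCluster hH x)).imp <|
      (measurableSet_setOfPred.1 (measurableSet_inInfiniteCluster hH y)).imp <|
        measurableSet_setOfPred.1 (measurableSet_reachable hH x y)

end Measurability

/-! ### The open subgraph of the lattice -/

section Lattice

variable {d : ℕ}

theorem openSubgraph_adj {ω : Config d} {x y : Fin d → ℤ} :
    (openSubgraph ω).Adj x y ↔ ∃ h : (lattice d).Adj x y, ω ⟨s(x, y), h⟩ = true := by
  constructor
  · rintro ⟨⟨⟨e, he⟩, hω, rfl⟩, -⟩
    exact ⟨he, hω⟩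
  · rintro ⟨h, hω⟩
    exact ⟨⟨⟨s(x, y), h⟩, hω, rfl⟩, h.ne⟩

theorem openSubgraph_le_lattice (ω : Config d) : openSubgraph ω ≤ lattice d :=
  fun _ _ h => (openSubgraph_adj.1 h).1

theorem openSubgraph_translate (a : Fin d → ℤ) (ω : Config d) :
    openSubgraph (translate a ω) = (openSubgraph ω).comap (Equiv.addRight a) := by
  ext x y
  rw [SimpleGraph.comap_adj, openSubgraph_adj, openSubgraph_adj]
  constructor
  · rintro ⟨h, hω⟩
    exact ⟨(translation a).map_rel_iff.2 h, hω⟩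
  · rintro ⟨h, hω⟩
    exact ⟨(translation a).map_rel_iff.1 h, hω⟩

theorem measurableSet_openSubgraph_adj (x y : Fin d → ℤ) :
    MeasurableSet {ω : Config d | (openSubgraph ω).Adj x y} := by
  simp only [openSubgraph_adj]
  by_cases h : (lattice d).Adj x y
  · simp only [h, exists_true_left]
    exact measurable_pi_apply (X := fun _ : Edge d => Bool) _ (measurableSet_singleton true)
  · simp [h]

/-- The edges with both ends in `B`. -/
def edgesWithin (B : Set (Fin d → ℤ)) : Set (Edge d) := {e | ∀ v ∈ e.1, v ∈ B}

theorem finite_edgesWithin {B : Set (Fin d → ℤ)} (hB : B.Finite) : (edgesWithin B).Finite := by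
  refine Set.Finite.of_finite_image (f := Subtype.val) ?_ Subtype.val_injective.injOn
  refine ((hB.prod hB).image fun p => s(p.1, p.2)).subset ?_
  rintro _ ⟨⟨⟨x, y⟩, hxy⟩, h, rfl⟩
  exact ⟨(x, y), ⟨h x (Sym2.mem_mk_left x y), h y (Sym2.mem_mk_right x y)⟩, rfl⟩

theorem openSubgraph_openEdges_adj {B : Set (Fin d → ℤ)} {ω : Config d} {x y : Fin d → ℤ} :
    (openSubgraph (openEdges (edgesWithin B) ω)).Adj x y ↔
      (openSubgraph ω).Adj x y ∨ (lattice d).Adj x y ∧ x ∈ B ∧ y ∈ B := by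
  have hmem : ∀ h : (lattice d).Adj x y,
      (⟨s(x, y), h⟩ : Edge d) ∈ edgesWithin B ↔ x ∈ B ∧ y ∈ B := by
    intro h
    simp [edgesWithin]
  simp only [openSubgraph_adj]
  by_cases h : (lattice d).Adj x y
  · by_cases hB : x ∈ B ∧ y ∈ B
    · simp [h, hB, openEdges_of_mem ((hmem h).2 hB)]
    · simp [h, hB, openEdges_of_notMem (mt (hmem h).1 hB)]
  · simp [h]

theorem openSubgraph_le_openEdges (S : Set (Edge d)) (ω : Config d) :
    openSubgraph ω ≤ openSubgraph (openEdges S ω) := by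
  intro x y h
  obtain ⟨h, hω⟩ := openSubgraph_adj.1 h
  refine openSubgraph_adj.2 ⟨h, ?_⟩
  by_cases hS : (⟨s(x, y), h⟩ : Edge d) ∈ S
  · exact openEdges_of_mem hS ω
  · rwa [openEdges_of_notMem hS]

theorem avoid_openSubgraph_openEdges (B : Set (Fin d → ℤ)) (ω : Config d) :
    avoid (openSubgraph (openEdges (edgesWithin B) ω)) B = avoid (openSubgraph ω) B := by
  ext x y
  change (_ ∧ _) ↔ (_ ∧ _)
  rw [openSubgraph_openEdges_adj]
  tauto

theorem lattice_adj_add_single (x : Fin d → ℤ) (i : Fin d) :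
    (lattice d).Adj x (x + Pi.single i 1) := by
  change ∑ j, |x j - (x + Pi.single i 1 : Fin d → ℤ) j| = 1
  rw [Finset.sum_eq_single i] <;> simp +contextual

theorem lattice_reachable_add_single (x : Fin d → ℤ) (i : Fin d) (k : ℤ) :
    (lattice d).Reachable x (x + Pi.single i k) := by
  induction k using Int.induction_on with
  | zero => simp
  | succ k ih =>
    have := lattice_adj_add_single (x + Pi.single i (k : ℤ)) i
    rw [add_assoc, ← Pi.single_add] at this
    exact ih.trans this.reachable
  | pred k ih =>
    have := lattice_adj_add_single (x + Pi.single i (-(k : ℤ) - 1)) i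
    rw [add_assoc, ← Pi.single_add, sub_add_cancel] at this
    exact ih.trans this.symm.reachable

theorem lattice_preconnected : (lattice d).Preconnected := by
  have key : ∀ (s : Finset (Fin d)) (x y : Fin d → ℤ),
      (lattice d).Reachable x (x + ∑ i ∈ s, Pi.single i (y i)) := by
    intro s x y
    induction s using Finset.induction_on with
    | empty => simp
    | insert i s hi ih =>
      rw [Finset.sum_insert hi, add_comm (Pi.single (M := fun _ => ℤ) i (y i)), ← add_assoc]
      exact ih.trans (lattice_reachable_add_single _ i (y i))
  intro x y
  have := key Finset.univ x (y - x)
  rwa [Finset.univ_sum_single, add_sub_cancel] at this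

theorem abs_sub_le_one_of_lattice_adj {x y : Fin d → ℤ} (h : (lattice d).Adj x y) (i : Fin d) :
    |x i - y i| ≤ 1 := by
  have h' : ∑ j, |x j - y j| = 1 := h
  rw [← h']
  exact Finset.single_le_sum (f := fun j => |x j - y j|) (fun j _ => abs_nonneg _)
    (Finset.mem_univ i)

theorem finite_lattice_neighbors {B : Set (Fin d → ℤ)} (hB : B.Finite) :
    {w | ∃ v ∈ B, (lattice d).Adj v w}.Finite := by
  refine (hB.biUnion fun v _ => Set.finite_Icc (v - 1) (v + 1)).subset ?_
  rintro w ⟨v, hv, hvw⟩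
  refine Set.mem_biUnion hv ⟨fun i => ?_, fun i => ?_⟩ <;>
  · have := abs_le.1 (abs_sub_le_one_of_lattice_adj hvw i)
    simp only [Pi.sub_apply, Pi.add_apply, Pi.one_apply]
    omega

/-- Opening all edges within a set that is connected in the lattice makes it connected. -/
theorem reachable_within_openEdges {B : Set (Fin d → ℤ)} (hB : ((lattice d).induce B).Preconnected)
    (ω : Config d) {p q : Fin d → ℤ} (hp : p ∈ B) (hq : q ∈ B) :
    (avoid (openSubgraph (openEdges (edgesWithin B) ω)) Bᶜ).Reachable p q := by
  let φ : (lattice d).induce B →g avoid (openSubgraph (openEdges (edgesWithin B) ω)) Bᶜ :=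
    { toFun := Subtype.val
      map_rel' := fun {v w} h => ⟨openSubgraph_openEdges_adj.2 (Or.inr ⟨h, v.2, w.2⟩),
        fun h => h v.2, fun h => h w.2⟩ }
  exact (hB ⟨p, hp⟩ ⟨q, hq⟩).map φ

theorem preimage_translate_atMostOneInfiniteCluster (a : Fin d → ℤ) :
    translate a ⁻¹' {ω : Config d | AtMostOneInfiniteCluster (openSubgraph ω)} =
      {ω | AtMostOneInfiniteCluster (openSubgraph ω)} := by
  ext ω
  simp only [Set.mem_preimage, Set.mem_ofPred_eq, openSubgraph_translate, AtMostOneInfiniteCluster,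
    inInfiniteCluster_comap, reachable_comap]
  refine ⟨fun h x y => ?_, fun h x y => h _ _⟩
  simpa using h ((Equiv.addRight a).symm x) ((Equiv.addRight a).symm y)

theorem numInfiniteClusters_mem_iff (ω : Config d) :
    numInfiniteClusters ω ∈ ({0, 1} : Set ℕ∞) ↔ AtMostOneInfiniteCluster (openSubgraph ω) := by
  have h01 : ∀ n : ℕ∞, n ∈ ({0, 1} : Set ℕ∞) ↔ n ≤ 1 := fun n => by
    rw [Set.mem_insert_iff, Set.mem_singleton_iff, Order.le_one_iff]
  have hsupp : ∀ x, ((openSubgraph ω).connectedComponentMk x).supp.Infinite ↔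
      InInfiniteCluster (openSubgraph ω) x := by
    intro x
    have : ((openSubgraph ω).connectedComponentMk x).supp = {y | (openSubgraph ω).Reachable x y} := by
      ext y
      simp [SimpleGraph.ConnectedComponent.mem_supp_iff, SimpleGraph.ConnectedComponent.eq,
        SimpleGraph.reachable_comm]
    rw [this, InInfiniteCluster]
  rw [h01, numInfiniteClusters, Set.encard_le_one_iff]
  constructor
  · intro h x y hx hy
    exact SimpleGraph.ConnectedComponent.eq.1 (h _ _ ((hsupp x).2 hx) ((hsupp y).2 hy))
  · intro h C D hC hD
    induction C using SimpleGraph.ConnectedComponent.ind with | _ x =>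
    induction D using SimpleGraph.ConnectedComponent.ind with | _ y =>
    exact SimpleGraph.ConnectedComponent.eq.2 (h x y ((hsupp x).1 hC) ((hsupp y).1 hD))

end Lattice

/-! ### Furcation sets have probability zero -/

section Counting

theorem sum_measure_le_of_card_le {Ω ι : Type*} [MeasurableSpace Ω] {μ : Measure Ω}
    [IsProbabilityMeasure μ] (s : Finset ι) {T : ι → Set Ω} (hT : ∀ i, MeasurableSet (T i)) {n : ℕ}
    (hn : ∀ ω, ∀ t ⊆ s, (∀ i ∈ t, ω ∈ T i) → t.card ≤ n) : ∑ i ∈ s, μ (T i) ≤ n := by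
  classical
  calc ∑ i ∈ s, μ (T i) = ∑ i ∈ s, ∫⁻ ω, (T i).indicator 1 ω ∂μ :=
        Finset.sum_congr rfl fun i _ => (lintegral_indicator_one (hT i)).symm
    _ = ∫⁻ ω, ∑ i ∈ s, (T i).indicator 1 ω ∂μ :=
        (lintegral_finsetSum _ fun i _ => measurable_one.indicator (hT i)).symm
    _ ≤ ∫⁻ _, (n : ENNReal) ∂μ := by
        refine lintegral_mono fun ω => ?_
        simp only [Set.indicator_apply, Pi.one_apply]
        rw [Finset.sum_boole]
        exact_mod_cast hn ω _ (Finset.filter_subset _ _) fun i hi => (Finset.mem_filter.1 hi).2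
    _ = n := by simp

theorem card_Icc_const (d : ℕ) {a b : ℤ} {m : ℕ} (h : b + 1 - a = m) :
    (Finset.Icc (fun _ : Fin d => a) fun _ => b).card = m ^ d := by
  rw [Pi.card_Icc]
  simp [h]

variable {d : ℕ}

/-- In a cube of side `s * N` there is room for `N ^ d` disjoint translates of a set `B`
contained in a cube of side `s = 2 * L + 1`. Only as many of them can be furcation sets as the outer boundary of the cube has
vertices, and each is one with the same probability. -/
theorem pow_mul_measure_isFurcation_le {μ : Measure (Config d)} [IsProbabilityMeasure μ]
    (hinv : TranslationInvariant μ) {B : Set (Fin d → ℤ)} {L : ℕ}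
    (hL : ∀ v ∈ B, ∀ i, -(L : ℤ) ≤ v i ∧ v i ≤ L) (N : ℕ) :
    (N : ENNReal) ^ d * μ {ω | IsFurcation (openSubgraph ω) B} ≤
      (((2 * L + 1) * N + 2) ^ d - ((2 * L + 1) * N) ^ d : ℕ) := by
  classical
  obtain ⟨g, hg⟩ := Countable.exists_injective_nat (Fin d → ℤ)
  let a : (Fin d → Fin N) → Fin d → ℤ := fun k i => (2 * L + 1) * (k i : ℕ)
  let T : (Fin d → Fin N) → Set (Config d) :=
    fun k => {ω | IsFurcation (openSubgraph ω) (Equiv.addRight (a k) '' B)}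
  have hTm : ∀ k, MeasurableSet (T k) := fun k =>
    measurableSet_isFurcation measurableSet_openSubgraph_adj _
  have hle : ∀ k, μ {ω | IsFurcation (openSubgraph ω) B} ≤ μ (T k) := by
    intro k
    rw [← (hinv (a k)).measure_preimage
      (measurableSet_isFurcation measurableSet_openSubgraph_adj B).nullMeasurableSet]
    refine measure_mono fun ω hω => ?_
    have hω' : IsFurcation (openSubgraph (translate (a k) ω)) B := hω
    rw [openSubgraph_translate] at hω'
    exact hω'.image
  let Q : Finset (Fin d → ℤ) :=
    Finset.Icc (fun _ => -(L : ℤ)) fun _ => (2 * L + 1) * N - 1 - L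
  let R : Finset (Fin d → ℤ) :=
    Finset.Icc (fun _ => -(L : ℤ) - 1) fun _ => (2 * L + 1) * N - L
  have hQR : Q ⊆ R := Finset.Icc_subset_Icc (fun _ => by simp) fun _ => by
    simp only; omega
  have hcard : (R \ Q).card = ((2 * L + 1) * N + 2) ^ d - ((2 * L + 1) * N) ^ d := by
    rw [Finset.card_sdiff_of_subset hQR]
    congr 1
    · exact card_Icc_const d (by push_cast; ring)
    · exact card_Icc_const d (by push_cast; ring)
  have hbd : ∀ u ∈ Q, ∀ w ∉ Q, (lattice d).Adj u w → w ∈ R \ Q := by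
    intro u hu w hw huw
    refine Finset.mem_sdiff.2 ⟨Finset.mem_Icc.2 ⟨fun i => ?_, fun i => ?_⟩, hw⟩ <;>
    · have h1 := (Finset.mem_Icc.1 hu).1 i
      have h2 := (Finset.mem_Icc.1 hu).2 i
      have := abs_le.1 (abs_sub_le_one_of_lattice_adj huw i)
      simp only at h1 h2 ⊢
      omega
  have hBQ : ∀ k, Equiv.addRight (a k) '' B ⊆ (Q : Set (Fin d → ℤ)) := by
    rintro k _ ⟨v, hv, rfl⟩
    refine Finset.mem_coe.2 (Finset.mem_Icc.2 ⟨fun i => ?_, fun i => ?_⟩)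
    · have h1 : 0 ≤ a k i := by positivity
      have := hL v hv i
      change -(L : ℤ) ≤ v i + a k i
      omega
    · have h1 : a k i ≤ (2 * L + 1) * (N - 1) := by
        have : ((k i : ℕ) : ℤ) ≤ N - 1 := by have := (k i).2; omega
        exact mul_le_mul_of_nonneg_left this (by positivity)
      have := hL v hv i
      change v i + a k i ≤ (2 * L + 1) * N - 1 - L
      linarith
  have hdisj : ∀ k l, k ≠ l →
      Disjoint (Equiv.addRight (a k) '' B) (Equiv.addRight (a l) '' B) := by
    intro k l hkl
    refine Set.disjoint_left.2 ?_
    rintro _ ⟨v, hv, rfl⟩ ⟨w, hw, hwv⟩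
    refine hkl (funext fun i => ?_)
    have h1 : w i + (2 * L + 1) * (l i : ℕ) = v i + (2 * L + 1) * (k i : ℕ) := congrFun hwv i
    have hv' := hL v hv i
    have hw' := hL w hw i
    have h2 : (2 * L + 1 : ℤ) * ((k i : ℕ) - (l i : ℕ)) = w i - v i := by linarith
    have h3 : w i - v i = 0 := by
      refine Int.eq_zero_of_abs_lt_dvd (Dvd.intro _ h2) ?_
      rw [abs_lt]
      omega
    rw [h3, mul_eq_zero] at h2
    exact Fin.ext (by omega)
  have hsum := sum_measure_le_of_card_le (μ := μ) Finset.univ hTm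
    (n := ((2 * L + 1) * N + 2) ^ d - ((2 * L + 1) * N) ^ d) fun ω t _ ht => by
      rw [← hcard]
      exact card_furcation_le (G := openSubgraph ω) t Q (R \ Q) hg Finset.disjoint_sdiff
        (fun u hu w hw h => hbd u hu w hw (openSubgraph_le_lattice ω h)) _
        (fun k _ => hBQ k) (fun k _ l _ => hdisj k l) ht
  refine le_trans ?_ hsum
  calc (N : ENNReal) ^ d * μ {ω | IsFurcation (openSubgraph ω) B}
      = ∑ _k : Fin d → Fin N, μ {ω | IsFurcation (openSubgraph ω) B} := by simp
    _ ≤ _ := Finset.sum_le_sum fun k _ => hle k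

/-- A given finite set is almost surely not a furcation set: furcation sets would have positive
density, whereas their number in a cube is at most of the order of its surface. -/
theorem measure_isFurcation_eq_zero {μ : Measure (Config d)} [IsProbabilityMeasure μ]
    (hinv : TranslationInvariant μ) {B : Set (Fin d → ℤ)} (hB : B.Finite) :
    μ {ω | IsFurcation (openSubgraph ω) B} = 0 := by
  obtain ⟨L, hL⟩ : ∃ L : ℕ, ∀ v ∈ B, ∀ i, -(L : ℤ) ≤ v i ∧ v i ≤ L := by
    refine ⟨∑ v ∈ hB.toFinset, ∑ i, (v i).natAbs, fun v hv i => ?_⟩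
    have h1 : (v i).natAbs ≤ ∑ j, (v j).natAbs :=
      Finset.single_le_sum (f := fun j => (v j).natAbs) (fun _ _ => Nat.zero_le _)
        (Finset.mem_univ i)
    have h2 : ∑ j, (v j).natAbs ≤ ∑ w ∈ hB.toFinset, ∑ j, (w j).natAbs :=
      Finset.single_le_sum (f := fun w : Fin d → ℤ => ∑ j, (w j).natAbs) (fun _ _ => Nat.zero_le _)
        (hB.mem_toFinset.2 hv)
    omega
  set p := μ {ω | IsFurcation (openSubgraph ω) B} with hp
  have hp1 : p ≠ ⊤ := measure_ne_top _ _
  have hbound : ∀ N : ℕ, p.toReal ≤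
      ((2 * L + 1 : ℝ) + 2 * (1 / ((N : ℝ) + 1))) ^ d - (2 * L + 1 : ℝ) ^ d := by
    intro N
    have h := pow_mul_measure_isFurcation_le hinv hL (N + 1)
    rw [← hp] at h
    have h' := ENNReal.toReal_mono (ENNReal.natCast_ne_top _) h
    rw [ENNReal.toReal_mul, ENNReal.toReal_pow, ENNReal.toReal_natCast, ENNReal.toReal_natCast,
      Nat.cast_sub (Nat.pow_le_pow_left (by omega) d)] at h'
    push_cast at h'
    have hN : (0 : ℝ) < (N : ℝ) + 1 := by positivity
    have hNd : (0 : ℝ) < ((N : ℝ) + 1) ^ d := by positivity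
    refine le_of_mul_le_mul_left (h'.trans_eq ?_) hNd
    rw [mul_sub, ← mul_pow, ← mul_pow]
    congr 2
    · field_simp
    · ring
  have hlim : Filter.Tendsto (fun N : ℕ =>
      ((2 * L + 1 : ℝ) + 2 * (1 / ((N : ℝ) + 1))) ^ d - (2 * L + 1 : ℝ) ^ d) Filter.atTop
      (nhds (((2 * L + 1 : ℝ) + 2 * 0) ^ d - (2 * L + 1 : ℝ) ^ d)) :=
    (((tendsto_one_div_add_atTop_nhds_zero_nat (𝕜 := ℝ)).const_mul 2).const_add _ |>.pow d).sub_const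
      _
  have h0 : p.toReal ≤ 0 := by
    simpa using ge_of_tendsto' hlim hbound
  exact (ENNReal.toReal_eq_zero_iff p).1 (le_antisymm h0 ENNReal.toReal_nonneg) |>.resolve_right hp1

end Counting

/-! ### Almost sure uniqueness -/

section Uniqueness

variable {d : ℕ} {μ : Measure (Config d)} [IsProbabilityMeasure μ]

/-- Almost surely there are no three distinct infinite clusters: opening the edges of a finite
connected set that contains a vertex of each would produce a furcation set. -/
theorem ae_not_three_clusters (hinv : TranslationInvariant μ) (hfe : FiniteEnergy μ)
    (x y z : Fin d → ℤ) : ∀ᵐ ω ∂μ, InInfiniteCluster (openSubgraph ω) x →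
      InInfiniteCluster (openSubgraph ω) y → InInfiniteCluster (openSubgraph ω) z →
      (openSubgraph ω).Reachable x y ∨ (openSubgraph ω).Reachable x z ∨
        (openSubgraph ω).Reachable y z := by
  classical
  obtain ⟨B, hxyz, hB⟩ := SimpleGraph.extend_finset_to_connected (lattice_preconnected (d := d))
    (t := {x, y, z}) (by simp)
  have hnull := (hfe.quasiMeasurePreserving_openEdges
    (finite_edgesWithin B.finite_toSet)).preimage_null
    (measure_isFurcation_eq_zero hinv B.finite_toSet)
  refine measure_mono_null (fun ω hω => ?_) hnull
  by_contra hcon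
  refine hω fun hx hy hz => ?_
  by_contra! hn
  exact hcon (isFurcation_of_three_clusters (openSubgraph_le_openEdges _ ω) B.finite_toSet
    ((finite_lattice_neighbors B.finite_toSet).subset fun w ⟨v, hv, hvw⟩ =>
      ⟨v, hv, openSubgraph_le_lattice ω hvw⟩)
    (avoid_openSubgraph_openEdges _ ω)
    (fun p hp q hq => reachable_within_openEdges hB.preconnected ω hp hq)
    (hxyz (by simp)) (hxyz (by simp)) (hxyz (by simp)) hx hy hz hn.1 hn.2.1 hn.2.2)

/-- Almost surely there is at most one infinite cluster. If there were exactly two, then opening the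
edges of a finite connected set that meets both would leave only one, although the event of having
at most one is almost surely not affected by opening finitely many edges. -/
theorem ae_atMostOneInfiniteCluster (hd : 0 < d) (hinv : TranslationInvariant μ)
    (hfe : FiniteEnergy μ) : ∀ᵐ ω ∂μ, AtMostOneInfiniteCluster (openSubgraph ω) := by
  classical
  have h3 : ∀ᵐ ω ∂μ, ∀ x y z, InInfiniteCluster (openSubgraph ω) x →
      InInfiniteCluster (openSubgraph ω) y → InInfiniteCluster (openSubgraph ω) z →
      (openSubgraph ω).Reachable x y ∨ (openSubgraph ω).Reachable x z ∨
        (openSubgraph ω).Reachable y z :=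
    ae_all_iff.2 fun x => ae_all_iff.2 fun y => ae_all_iff.2 fun z =>
      ae_not_three_clusters hinv hfe x y z
  have hA : ∀ᵐ ω ∂μ, ∀ B : Finset (Fin d → ℤ),
      AtMostOneInfiniteCluster (openSubgraph (openEdges (edgesWithin (B : Set (Fin d → ℤ))) ω)) →
        AtMostOneInfiniteCluster (openSubgraph ω) :=
    ae_all_iff.2 fun B => (preimage_openEdges_ae_eq hd hinv hfe
      (measurableSet_atMostOneInfiniteCluster measurableSet_openSubgraph_adj)
      preimage_translate_atMostOneInfiniteCluster
      (finite_edgesWithin B.finite_toSet)).mem_iff.mono fun ω hω => hω.1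
  filter_upwards [h3, hA] with ω h3 hA x y hx hy
  by_contra hxy
  obtain ⟨B, hxyB, hB⟩ := SimpleGraph.extend_finset_to_connected (lattice_preconnected (d := d))
    (t := {x, y}) (by simp)
  have hle := openSubgraph_le_openEdges (edgesWithin (B : Set (Fin d → ℤ))) ω
  have hxy' := (reachable_within_openEdges hB.preconnected ω (hxyB (by simp) : x ∈ (B : Set _))
    (hxyB (by simp) : y ∈ (B : Set _))).mono (avoid_le _ _)
  -- Every infinite cluster after opening contains `x`.
  have key : ∀ u, InInfiniteCluster (openSubgraph (openEdges (edgesWithin ↑B) ω)) u →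
      (openSubgraph (openEdges (edgesWithin ↑B) ω)).Reachable x u := by
    intro u hu
    obtain ⟨z, huz, hz⟩ := exists_inInfiniteCluster_of_finite_change (G := openSubgraph ω)
      B.finite_toSet (fun v w hvw => (openSubgraph_openEdges_adj.1 hvw).imp_right fun h => h.2.2) hu
    rcases h3 x y z hx hy hz with h | h | h
    · exact absurd h hxy
    · exact (h.mono hle).trans huz.symm
    · exact hxy'.trans ((h.mono hle).trans huz.symm)
  exact hxy (hA B (fun u v hu hv => (key u hu).symm.trans (key v hv)) x y hx hy)

end Uniqueness

end BondPercolation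

theorem theorem2 (d : ℕ) (hd : 2 ≤ d) (μ : Measure (BondPercolation.Config d))
    [IsProbabilityMeasure μ]
    (hinv : BondPercolation.TranslationInvariant μ)
    (hfe : BondPercolation.FiniteEnergy μ) :
    MeasurableSet {ω : BondPercolation.Config d |
        BondPercolation.numInfiniteClusters ω ∈ ({0, 1} : Set ℕ∞)} ∧
      μ {ω : BondPercolation.Config d |
        BondPercolation.numInfiniteClusters ω ∈ ({0, 1} : Set ℕ∞)} = 1 := by
  simp only [BondPercolation.numInfiniteClusters_mem_iff]
  have hm := BondPercolation.measurableSet_atMostOneInfiniteCluster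
    (BondPercolation.measurableSet_openSubgraph_adj (d := d))
  refine ⟨hm, ?_⟩
  rw [prob_compl_eq_zero_iff hm |>.symm]
  exact BondPercolation.ae_atMostOneInfiniteCluster (by omega) hinv hfe
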